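/- There exist absolute constants $C,c>0$ such that the following holds. Let $\Sigma\in\mathbb{R}^{n\times n}$ be a symmetric positive definite matrix with smallest and largest eigenvalues $\lambda_{\min}(\Sigma)$, $\lambda_{\max}(\Sigma)$ and condition number $\kappa(\Sigma)=\lambda_{\max}(\Sigma)/\lambda_{\min}(\Sigma)$, let $0<s\le n$ be a real number, and let $x\in\mathbb{R}^n$ have at most $s$ non-zero entries and satisfy $\|\Sigma^{1/2}x\|_2=1$. Let $a_1,\dots,a_m$ be independent random vectors in $\mathbb{R}^n$ with distribution $N(0,\Sigma)$, and let $y_1,\dots,y_m$ be $\{-1,1\}$-valued random variables that are conditionally independent given $\{a_1,\dots,a_m\}$ and satisfy $$\mathbb{E}\big[y_i\mid a_1,\dots,a_m\big]=\theta(\langle a_i,x\rangle)\quad\text{a.s.},\qquad i=1,\dots,m,$$ for some measurable function $\theta:\mathbb{R}\to\mathbb{R}$ with $\lambda:=\mathbb{E}\,[\theta(g)g]>0$, where $g\sim N(0,1)$. Let $\delta>0$ and suppose that $$m\ \ge\ C\,\kappa(\Sigma)\,\delta^{-2}\,s\log(2n/s).$$ Then with probability at least $1-8\exp(-c\delta^2m)$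 the convex program $$\max_{x'\in\mathbb{R}^n}\ \sum_{i=1}^m y_i\langle a_i,x'\rangle\quad\text{subject to}\quad \|x'\|_1\le\sqrt{s/\lambda_{\min}(\Sigma)}\ \text{ and }\ \|\Sigma^{1/2}x'\|_2\le 1$$ has a solution, and every solution $\hat x$ satisfies $$\lambda_{\min}(\Sigma)\,\|\hat x-x\|_2^2\ \le\ \|\Sigma^{1/2}\hat x-\Sigma^{1/2}x\|_2^2\ \le\ \delta/\lambda .$$ -/

import Mathlib

open MeasureTheory ProbabilityTheory
open scoped MatrixOrder

noncomputable section

namespace OneBit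

/-- The smallest eigenvalue of a (symmetric) real matrix. -/
def lambdaMin {n : ℕ} (S : Matrix (Fin n) (Fin n) ℝ) : ℝ := sInf (spectrum ℝ S)

/-- The largest eigenvalue of a (symmetric) real matrix. -/
def lambdaMax {n : ℕ} (S : Matrix (Fin n) (Fin n) ℝ) : ℝ := sSup (spectrum ℝ S)

/-- The condition number of a positive definite matrix. -/
def condNumber {n : ℕ} (S : Matrix (Fin n) (Fin n) ℝ) : ℝ := lambdaMax S / lambdaMin S

/-- The map `x ↦ S^{1/2} x` on Euclidean space, where `S^{1/2}` is the positive semidefinite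
square root of the positive semidefinite matrix `S`. -/
def sqrtMap {n : ℕ} (S : Matrix (Fin n) (Fin n) ℝ) :
    EuclideanSpace ℝ (Fin n) →L[ℝ] EuclideanSpace ℝ (Fin n) :=
  Matrix.toEuclideanCLM (𝕜 := ℝ) (CFC.sqrt S)

/-- The `ℓ₁` norm. -/
def l1Norm {n : ℕ} (x : EuclideanSpace ℝ (Fin n)) : ℝ := ∑ i, |x i|

/-- The number of nonzero entries. -/
def l0Norm {n : ℕ} (x : EuclideanSpace ℝ (Fin n)) : ℕ := hammingNorm (fun i => x i)

/-- The correlation coefficient `𝔼 θ(g) g`, with `g` standard normal. -/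
def correlation (θ : ℝ → ℝ) : ℝ := ∫ z, θ z * z ∂(gaussianReal 0 1)

/-- The real random variables `y i` are conditionally independent given the σ-algebra `F`. -/
def CondIndepGiven {Ω : Type*} {m : ℕ} (F : MeasurableSpace Ω) [mΩ : MeasurableSpace Ω]
    (μ : Measure Ω) (y : Fin m → Ω → ℝ) : Prop :=
  ∀ (T : Finset (Fin m)) (B : Fin m → Set ℝ), (∀ i, MeasurableSet (B i)) →
    μ⟦⋂ i ∈ T, y i ⁻¹' B i | F⟧ =ᵐ[μ] ∏ i ∈ T, μ⟦y i ⁻¹' B i | F⟧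

/-- The one-bit measurement model with covariance matrix `S`, signal `x` and nonlinearity `θ`:
the `a i` are independent with law `N(0, S)`; given all the `a i`, the `y i` are independent
`{-1, 1}`-valued random variables with conditional mean `θ ⟨a i, x⟩`; and `𝔼 θ(g) g > 0`. -/
structure IsModel {Ω : Type*} [MeasurableSpace Ω] (μ : Measure Ω) {m n : ℕ}
    (S : Matrix (Fin n) (Fin n) ℝ) (x : EuclideanSpace ℝ (Fin n)) (θ : ℝ → ℝ)
    (a : Fin m → Ω → EuclideanSpace ℝ (Fin n)) (y : Fin m → Ω → ℝ) : Prop where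
  measurable_a : ∀ i, Measurable (a i)
  law_a : ∀ i, HasLaw (a i) (multivariateGaussian 0 S) μ
  indep_a : iIndepFun a μ
  measurable_y : ∀ i, Measurable (y i)
  y_mem : ∀ i ω, y i ω = 1 ∨ y i ω = -1
  condIndep_y : CondIndepGiven (MeasurableSpace.comap (fun ω i => a i ω) inferInstance) μ y
  measurable_theta : Measurable θ
  condMean_y : ∀ i, μ[y i | MeasurableSpace.comap (fun ω i => a i ω) inferInstance]
    =ᵐ[μ] fun ω => θ (inner ℝ (a i ω) x)
  correlation_pos : 0 < correlation θ

/-- The feasible set `‖x'‖₁ ≤ √(s / λ_min(S))`, `‖S^{1/2} x'‖₂ ≤ 1`. -/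
def feasibleSet {n : ℕ} (S : Matrix (Fin n) (Fin n) ℝ) (s : ℝ) :
    Set (EuclideanSpace ℝ (Fin n)) :=
  {x' | l1Norm x' ≤ √(s / lambdaMin S) ∧ ‖sqrtMap S x'‖ ≤ 1}

/-- `xhat` solves the convex program `max ∑ i, y i * ⟨a i, x'⟩` subject to `x' ∈ feasibleSet S s`,
for given measurement vectors `a` and measurements `y`. -/
def IsSolution {m n : ℕ} (S : Matrix (Fin n) (Fin n) ℝ) (s : ℝ)
    (a : Fin m → EuclideanSpace ℝ (Fin n)) (y : Fin m → ℝ)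
    (xhat : EuclideanSpace ℝ (Fin n)) : Prop :=
  xhat ∈ feasibleSet S s ∧
    IsMaxOn (fun x' => ∑ i, y i * inner ℝ (a i) x') (feasibleSet S s) xhat

end OneBit

end

namespace OneBit

/-! Write `A = S^{1/2}`, `λ = correlation θ`, and let `D(u)` (`deviation`) be the sum of the `y i *
⟨a i, u⟩` minus its mean `m λ ⟨A x, A u⟩`. Optimality of `xhat` against the feasible `x` gives `m λ
⟨A x, A (x - xhat)⟩ ≤ D(xhat - x)`, and `(xhat - x)/2` is feasible. So a uniform bound `D ≤ δ m / 4`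
on the feasible set yields `‖A xhat - A x‖² ≤ δ / λ`.

The uniform bound replaces Gaussian widths by Maurey's empirical method with a penalty. Each
feasible `u` is a convex combination of the points `0, ± r e_j`, and some average `w` of `k` of them
has `D(w) - c ‖A w‖² ≥ D(u) - c (‖A u‖² + B / k)`, where `B` bounds `‖A ·‖²` at these points
(`exists_sym_average`). The penalty is exactly the variance term of a Chernoff bound for `D(w)`
(`IsModel.measureReal_deviation_ge_le`), so no bound on `‖A w‖` is needed. A union bound over the
multisets of size `k` (`card_sym_cross_le`) finishes; `k` of order `κ s` makes `B / k ≤ 1`. -/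

/-! ### Quadratic form and extreme eigenvalues. -/

lemma inner_sqrtMap {n : ℕ} {S : Matrix (Fin n) (Fin n) ℝ} (hS : S.PosSemidef)
    (u v : EuclideanSpace ℝ (Fin n)) :
    inner ℝ (sqrtMap S u) (sqrtMap S v) = inner ℝ u (Matrix.toEuclideanCLM (𝕜 := ℝ) S v) := by
  have hsa : IsSelfAdjoint (sqrtMap S) := by
    have h : IsSelfAdjoint (CFC.sqrt S) := (CFC.sqrt_nonneg S).isSelfAdjoint
    exact h.map _
  rw [← ContinuousLinearMap.adjoint_inner_right, hsa.adjoint_eq]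
  have : sqrtMap S (sqrtMap S v) = (sqrtMap S * sqrtMap S) v := rfl
  rw [this, sqrtMap, ← map_mul, CFC.sqrt_mul_sqrt_self _ hS.nonneg]

lemma inner_sqrtMap_eq_dotProduct {n : ℕ} {S : Matrix (Fin n) (Fin n) ℝ} (hS : S.PosSemidef)
    (u v : EuclideanSpace ℝ (Fin n)) :
    inner ℝ (sqrtMap S u) (sqrtMap S v) = u.ofLp ⬝ᵥ S.mulVec v.ofLp := by
  rw [inner_sqrtMap hS, EuclideanSpace.inner_eq_star_dotProduct]
  simp [dotProduct_comm]

lemma spectrum_finite {n : ℕ} {S : Matrix (Fin n) (Fin n) ℝ} (hS : S.PosDef) :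
    (spectrum ℝ S).Finite := by
  rw [hS.1.spectrum_real_eq_range_eigenvalues]
  exact Set.finite_range _

lemma lambdaMin_mul_sq_le {n : ℕ} {S : Matrix (Fin n) (Fin n) ℝ} (hS : S.PosDef)
    (v : EuclideanSpace ℝ (Fin n)) : lambdaMin S * ‖v‖ ^ 2 ≤ ‖sqrtMap S v‖ ^ 2 := by
  have h : algebraMap ℝ _ (lambdaMin S) ≤ S :=
    algebraMap_le_of_le_spectrum (a := S)
      (fun x hx => csInf_le (spectrum_finite hS).bddBelow hx) hS.1
  have h2 := (Matrix.le_iff.mp h).dotProduct_mulVec_nonneg v.ofLp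
  rw [← real_inner_self_eq_norm_sq (sqrtMap S v), inner_sqrtMap_eq_dotProduct hS.posSemidef,
    EuclideanSpace.real_norm_sq_eq]
  simp only [Matrix.sub_mulVec, dotProduct_sub, star_trivial, Algebra.algebraMap_eq_smul_one,
    Matrix.smul_mulVec, Matrix.one_mulVec, dotProduct_smul, smul_eq_mul] at h2
  have : v.ofLp ⬝ᵥ v.ofLp = ∑ i, v i ^ 2 := by simp [dotProduct, sq]
  rw [this] at h2
  linarith

lemma sq_le_lambdaMax_mul {n : ℕ} {S : Matrix (Fin n) (Fin n) ℝ} (hS : S.PosDef)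
    (v : EuclideanSpace ℝ (Fin n)) : ‖sqrtMap S v‖ ^ 2 ≤ lambdaMax S * ‖v‖ ^ 2 := by
  have h : S ≤ algebraMap ℝ _ (lambdaMax S) :=
    le_algebraMap_of_spectrum_le (a := S)
      (fun x hx => le_csSup (spectrum_finite hS).bddAbove hx) hS.1
  have h2 := (Matrix.le_iff.mp h).dotProduct_mulVec_nonneg v.ofLp
  rw [← real_inner_self_eq_norm_sq (sqrtMap S v), inner_sqrtMap_eq_dotProduct hS.posSemidef,
    EuclideanSpace.real_norm_sq_eq]
  simp only [Matrix.sub_mulVec, dotProduct_sub, star_trivial, Algebra.algebraMap_eq_smul_one,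
    Matrix.smul_mulVec, Matrix.one_mulVec, dotProduct_smul, smul_eq_mul] at h2
  have : v.ofLp ⬝ᵥ v.ofLp = ∑ i, v i ^ 2 := by simp [dotProduct, sq]
  rw [this] at h2
  linarith

lemma spectrum_nonempty {n : ℕ} (hn : 0 < n) {S : Matrix (Fin n) (Fin n) ℝ} (hS : S.PosDef) :
    (spectrum ℝ S).Nonempty := by
  have : Nonempty (Fin n) := ⟨⟨0, hn⟩⟩
  rw [hS.1.spectrum_real_eq_range_eigenvalues]
  exact Set.range_nonempty _

lemma lambdaMin_pos {n : ℕ} (hn : 0 < n) {S : Matrix (Fin n) (Fin n) ℝ} (hS : S.PosDef) :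
    0 < lambdaMin S := by
  have h := (spectrum_nonempty hn hS).csInf_mem (spectrum_finite hS)
  rw [hS.1.spectrum_real_eq_range_eigenvalues] at h
  obtain ⟨i, hi⟩ := h
  rw [lambdaMin, hS.1.spectrum_real_eq_range_eigenvalues, ← hi]
  exact hS.eigenvalues_pos i

lemma lambdaMin_le_lambdaMax {n : ℕ} (hn : 0 < n) {S : Matrix (Fin n) (Fin n) ℝ}
    (hS : S.PosDef) : lambdaMin S ≤ lambdaMax S :=
  csInf_le_csSup (spectrum_nonempty hn hS) (spectrum_finite hS).bddBelow
    (spectrum_finite hS).bddAbove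

lemma one_le_condNumber {n : ℕ} (hn : 0 < n) {S : Matrix (Fin n) (Fin n) ℝ} (hS : S.PosDef) :
    1 ≤ condNumber S :=
  (one_le_div (lambdaMin_pos hn hS)).2 (lambdaMin_le_lambdaMax hn hS)

/-! ### The feasible set. -/

lemma l1Norm_sq_le {n : ℕ} (x : EuclideanSpace ℝ (Fin n)) :
    l1Norm x ^ 2 ≤ l0Norm x * ‖x‖ ^ 2 := by
  classical
  have h := Finset.sum_mul_sq_le_sq_mul_sq Finset.univ
    (fun i => if x i ≠ 0 then (1 : ℝ) else 0) (fun i => |x i|)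
  have h1 : ∑ i, (if x i ≠ 0 then (1 : ℝ) else 0) * |x i| = l1Norm x := by
    refine Finset.sum_congr rfl fun i _ => ?_
    by_cases hi : x i = 0 <;> simp [hi]
  have h2 : ∑ i, (if x i ≠ 0 then (1 : ℝ) else 0) ^ 2 = l0Norm x := by
    simp [l0Norm, hammingNorm, ite_pow, Finset.sum_ite]
  rw [h1, h2] at h
  simpa [EuclideanSpace.real_norm_sq_eq] using h

lemma l1Norm_smul {n : ℕ} (c : ℝ) (x : EuclideanSpace ℝ (Fin n)) :
    l1Norm (c • x) = |c| * l1Norm x := by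
  simp [l1Norm, abs_mul, Finset.mul_sum]

lemma l1Norm_sub_le {n : ℕ} (x y : EuclideanSpace ℝ (Fin n)) :
    l1Norm (x - y) ≤ l1Norm x + l1Norm y := by
  simp only [l1Norm, ← Finset.sum_add_distrib]
  exact Finset.sum_le_sum fun i _ => abs_sub _ _

/-- The feasible set is convex and symmetric; this lets a bound on it control differences of its
points. -/
lemma half_sub_mem_feasibleSet {n : ℕ} {S : Matrix (Fin n) (Fin n) ℝ} {s : ℝ}
    {x y : EuclideanSpace ℝ (Fin n)} (hx : x ∈ feasibleSet S s) (hy : y ∈ feasibleSet S s) :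
    (2⁻¹ : ℝ) • (x - y) ∈ feasibleSet S s := by
  constructor
  · rw [l1Norm_smul, abs_of_pos (by norm_num)]
    linarith [l1Norm_sub_le x y, hx.1, hy.1]
  · rw [map_smul, map_sub, norm_smul, Real.norm_of_nonneg (by norm_num)]
    linarith [norm_sub_le (sqrtMap S x) (sqrtMap S y), hx.2, hy.2]

lemma mem_feasibleSet_of_sparse {n : ℕ} (hn : 0 < n) {S : Matrix (Fin n) (Fin n) ℝ}
    (hS : S.PosDef) {s : ℝ} {x : EuclideanSpace ℝ (Fin n)} (hxs : (l0Norm x : ℝ) ≤ s)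
    (hx : ‖sqrtMap S x‖ = 1) : x ∈ feasibleSet S s := by
  refine ⟨Real.le_sqrt_of_sq_le ?_, hx.le⟩
  have hl := lambdaMin_pos hn hS
  have h := lambdaMin_mul_sq_le hS x
  rw [hx] at h
  rw [le_div_iff₀ hl]
  calc l1Norm x ^ 2 * lambdaMin S ≤ l0Norm x * ‖x‖ ^ 2 * lambdaMin S := by
        gcongr; exact l1Norm_sq_le x
    _ = l0Norm x * (lambdaMin S * ‖x‖ ^ 2) := by ring
    _ ≤ l0Norm x * 1 := by gcongr; simpa using h
    _ ≤ s := by simpa using hxs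

lemma continuous_l1Norm {n : ℕ} : Continuous (l1Norm (n := n)) := by
  unfold l1Norm; fun_prop

lemma isCompact_feasibleSet {n : ℕ} (hn : 0 < n) {S : Matrix (Fin n) (Fin n) ℝ}
    (hS : S.PosDef) (s : ℝ) : IsCompact (feasibleSet S s) := by
  have hl := lambdaMin_pos hn hS
  refine Metric.isCompact_of_isClosed_isBounded ?_ ?_
  · exact (isClosed_le continuous_l1Norm continuous_const).inter
      (isClosed_le (sqrtMap S).continuous.norm continuous_const)
  · refine (Metric.isBounded_closedBall (x := (0 : EuclideanSpace ℝ (Fin n)))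
      (r := √(1 / lambdaMin S))).subset fun v hv => ?_
    rw [mem_closedBall_zero_iff]
    refine Real.le_sqrt_of_sq_le ?_
    rw [le_div_iff₀ hl, mul_comm]
    exact (lambdaMin_mul_sq_le hS v).trans (pow_le_one₀ (norm_nonneg _) hv.2)

lemma exists_isSolution {m n : ℕ} {S : Matrix (Fin n) (Fin n) ℝ} {s : ℝ}
    (hc : IsCompact (feasibleSet S s)) (hne : (feasibleSet S s).Nonempty)
    (a : Fin m → EuclideanSpace ℝ (Fin n)) (y : Fin m → ℝ) : ∃ xhat, IsSolution S s a y xhat := by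
  obtain ⟨xhat, h1, h2⟩ := hc.exists_isMaxOn hne
    (f := fun x' => ∑ i, y i * inner ℝ (a i) x') (by fun_prop)
  exact ⟨xhat, h1, h2⟩

/-! ### Maurey's empirical method with a penalty. -/

/-- One step of Maurey's empirical method: some vertex does at least as well as the average. -/
lemma exists_vertex_step {α V H : Type*} [Fintype α] [AddCommGroup V] [Module ℝ V]
    [NormedAddCommGroup H] [InnerProductSpace ℝ H] (L : V →ₗ[ℝ] ℝ) (A : V →ₗ[ℝ] H)
    (e : α → V) (p : α → ℝ) (hp : ∀ i, 0 ≤ p i) (hp1 : ∑ i, p i = 1) {B c : ℝ} (hc : 0 ≤ c)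
    (hB : ∀ i, ‖A (e i)‖ ^ 2 ≤ B) (h : H) :
    ∃ i, -(c * B) ≤ L (e i - ∑ j, p j • e j)
      - c * (‖A (e i - ∑ j, p j • e j)‖ ^ 2 + inner ℝ h (A (e i - ∑ j, p j • e j))) := by
  set u := ∑ j, p j • e j with hu
  by_contra! hcon
  -- Linear terms have zero mean under the weights `p`, so only the quadratic term survives
  -- averaging.
  have hlin : ∀ M : V →ₗ[ℝ] ℝ, ∑ i, p i * M (e i - u) = 0 := by
    intro M
    have : ∑ i, p i * M (e i - u) = M (∑ i, p i • e i) - (∑ i, p i) * M u := by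
      simp [map_sum, mul_sub, Finset.sum_sub_distrib, Finset.sum_mul]
    rw [this, hp1, ← hu]; ring
  have h1 := hlin L
  have h2 : ∑ i, p i * inner ℝ h (A (e i - u)) = 0 := hlin ((innerₛₗ ℝ h).comp A)
  have h3 : ∑ i, p i * inner ℝ (A u) (A (e i - u)) = 0 := hlin ((innerₛₗ ℝ (A u)).comp A)
  -- The variance is at most the second moment.
  have h4 : ∑ i, p i * ‖A (e i - u)‖ ^ 2 ≤ B := by
    have : ∀ i, p i * ‖A (e i - u)‖ ^ 2 ≤ p i * B - 2 * (p i * inner ℝ (A u) (A (e i - u))) := by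
      intro i
      have e1 : ‖A (e i)‖ ^ 2
          = ‖A u‖ ^ 2 + 2 * inner ℝ (A u) (A (e i - u)) + ‖A (e i - u)‖ ^ 2 := by
        rw [← norm_add_sq_real, ← map_add]; simp
      nlinarith [hp i, hB i, sq_nonneg ‖A u‖, mul_le_mul_of_nonneg_left (hB i) (hp i),
        mul_nonneg (hp i) (sq_nonneg ‖A u‖)]
    calc _ ≤ ∑ i, (p i * B - 2 * (p i * inner ℝ (A u) (A (e i - u)))) :=
          Finset.sum_le_sum fun i _ => this i
      _ = B := by rw [Finset.sum_sub_distrib, ← Finset.sum_mul, ← Finset.mul_sum, h3, hp1]; ring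
  have h5 : ∑ i, p i * (L (e i - u) - c * (‖A (e i - u)‖ ^ 2 + inner ℝ h (A (e i - u))))
      < ∑ i, p i * -(c * B) := by
    obtain ⟨j, -, hj⟩ := Finset.exists_ne_zero_of_sum_ne_zero (hp1.trans_ne one_ne_zero)
    exact Finset.sum_lt_sum (fun i _ => mul_le_mul_of_nonneg_left (hcon i).le (hp i))
      ⟨j, Finset.mem_univ _, mul_lt_mul_of_pos_left (hcon j) ((hp j).lt_of_ne' hj)⟩
  rw [← Finset.sum_mul, hp1] at h5
  have h6 : ∑ i, p i * (L (e i - u) - c * (‖A (e i - u)‖ ^ 2 + inner ℝ h (A (e i - u))))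
      = ∑ i, p i * L (e i - u) - c * (∑ i, p i * ‖A (e i - u)‖ ^ 2
        + ∑ i, p i * inner ℝ h (A (e i - u))) := by
    rw [← Finset.sum_add_distrib, Finset.mul_sum, ← Finset.sum_sub_distrib]
    exact Finset.sum_congr rfl fun i _ => by ring
  rw [h6, h1, h2] at h5
  nlinarith

/-- Maurey's empirical method with a quadratic penalty. -/
lemma exists_sym_maurey {α V H : Type*} [Fintype α] [AddCommGroup V] [Module ℝ V]
    [NormedAddCommGroup H] [InnerProductSpace ℝ H] (L : V →ₗ[ℝ] ℝ) (A : V →ₗ[ℝ] H)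
    (e : α → V) (p : α → ℝ) (hp : ∀ i, 0 ≤ p i) (hp1 : ∑ i, p i = 1) {B c : ℝ} (hc : 0 ≤ c)
    (hB : ∀ i, ‖A (e i)‖ ^ 2 ≤ B) (h : H) (k : ℕ) :
    ∃ σ : Sym α k, -(c * B * k) ≤ L ((σ.1.map e).sum - (k : ℝ) • ∑ j, p j • e j)
      - c * (‖A ((σ.1.map e).sum - (k : ℝ) • ∑ j, p j • e j)‖ ^ 2
        + inner ℝ h (A ((σ.1.map e).sum - (k : ℝ) • ∑ j, p j • e j))) := by
  induction k with
  | zero => exact ⟨Sym.nil, by simp⟩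
  | succ k ih =>
    obtain ⟨σ, hσ⟩ := ih
    set u := ∑ j, p j • e j with hu
    set T := (σ.1.map e).sum - (k : ℝ) • u with hT
    -- The shift of `h` by `2 A T` supplies the cross term of `‖A T + A (e i - u)‖²`, so the costs
    -- of the steps add up.
    obtain ⟨i, hi⟩ := exists_vertex_step L A e p hp hp1 hc hB (h + (2 : ℝ) • A T)
    rw [← hu] at hi
    refine ⟨i ::ₛ σ, ?_⟩
    have hs : ((i ::ₛ σ).1.map e).sum - ((k + 1 : ℕ) : ℝ) • u = T + (e i - u) := by
      have : (i ::ₛ σ).1 = i ::ₘ σ.1 := rfl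
      rw [this, Multiset.map_cons, Multiset.sum_cons, hT]
      push_cast
      module
    rw [hs, map_add L, map_add A, norm_add_sq_real, inner_add_right]
    rw [inner_add_left, inner_smul_left] at hi
    simp only [conj_trivial] at hi
    push_cast
    linarith

/-- The average is `u + T / k`, with `T` the accumulated deviation; expanding its penalty around `u`
leaves an error `c * B / k`. -/
lemma exists_sym_average {α V H : Type*} [Fintype α] [AddCommGroup V] [Module ℝ V]
    [NormedAddCommGroup H] [InnerProductSpace ℝ H] (L : V →ₗ[ℝ] ℝ) (A : V →ₗ[ℝ] H)
    (e : α → V) (p : α → ℝ) (hp : ∀ i, 0 ≤ p i) (hp1 : ∑ i, p i = 1) {B c : ℝ} (hc : 0 ≤ c)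
    (hB : ∀ i, ‖A (e i)‖ ^ 2 ≤ B) {k : ℕ} (hk : 0 < k) :
    ∃ σ : Sym α k, L (∑ j, p j • e j) - c * (‖A (∑ j, p j • e j)‖ ^ 2 + B / k)
      ≤ L ((k : ℝ)⁻¹ • (σ.1.map e).sum) - c * ‖A ((k : ℝ)⁻¹ • (σ.1.map e).sum)‖ ^ 2 := by
  have hk' : (0 : ℝ) < k := by exact_mod_cast hk
  set u := ∑ j, p j • e j with hu
  -- After division by `k`, the coefficient `c / k` and drift `2 k A u` reproduce the cross and
  -- square terms of `c ‖A u + A T / k‖²`.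
  obtain ⟨σ, hσ⟩ := exists_sym_maurey L A e p hp hp1 (c := c / k) (by positivity) hB
    ((2 * k : ℝ) • A u) k
  rw [← hu] at hσ
  refine ⟨σ, ?_⟩
  set T := (σ.1.map e).sum - (k : ℝ) • u with hT
  have hW : (k : ℝ)⁻¹ • (σ.1.map e).sum = u + (k : ℝ)⁻¹ • T := by
    rw [hT, smul_sub, smul_smul, inv_mul_cancel₀ hk'.ne', one_smul]; abel
  rw [hW, map_add L, map_add A, map_smul, map_smul, norm_add_sq_real, norm_smul, inner_smul_right,
    smul_eq_mul, Real.norm_of_nonneg (by positivity)]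
  rw [inner_smul_left] at hσ
  simp only [conj_trivial] at hσ
  have := mul_le_mul_of_nonneg_left hσ (inv_nonneg.2 hk'.le)
  have e1 : (k : ℝ)⁻¹ * -(c / k * B * k) = - (c * (B / k)) := by field_simp
  have e2 : (k : ℝ)⁻¹ * (L T - c / k * (‖A T‖ ^ 2 + 2 * k * inner ℝ (A u) (A T)))
      = (k : ℝ)⁻¹ * L T - c * (2 * ((k : ℝ)⁻¹ * inner ℝ (A u) (A T)) + ((k : ℝ)⁻¹ * ‖A T‖) ^ 2) := by
    field_simp; ring
  rw [e1, e2] at this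
  linarith

/-! ### Vertices of the cross-polytope and their multisets. -/

/-- The vertices `0, ± r e_j` of the `ℓ₁` ball of radius `r`, together with its centre. -/
noncomputable def crossVertex {n : ℕ} (r : ℝ) : Option (Fin n × Bool) → EuclideanSpace ℝ (Fin n)
  | none => 0
  | some (j, b) => (if b then r else -r) • EuclideanSpace.single j 1

lemma norm_crossVertex_sq_le {n : ℕ} (r : ℝ) (i : Option (Fin n × Bool)) :
    ‖crossVertex r i‖ ^ 2 ≤ r ^ 2 := by
  rcases i with _ | ⟨j, b⟩
  · simp [crossVertex, sq_nonneg]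
  · cases b <;> simp [crossVertex, norm_smul]

lemma exists_weights_of_l1Norm_le {n : ℕ} {r : ℝ} (hr : 0 < r) {u : EuclideanSpace ℝ (Fin n)}
    (hu : l1Norm u ≤ r) :
    ∃ p : Option (Fin n × Bool) → ℝ, (∀ i, 0 ≤ p i) ∧ ∑ i, p i = 1 ∧
      ∑ i, p i • crossVertex r i = u := by
  -- The centre takes the mass left over when `l1Norm u < r`.
  refine ⟨fun i => match i with
    | none => 1 - l1Norm u / r
    | some (j, b) => if b then (u j)⁺ / r else (u j)⁻ / r, ?_, ?_, ?_⟩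
  · rintro (_ | ⟨j, b⟩)
    · simpa using (div_le_one hr).2 hu
    · cases b
      · exact div_nonneg (negPart_nonneg _) hr.le
      · exact div_nonneg (posPart_nonneg _) hr.le
  · rw [Fintype.sum_option, Fintype.sum_prod_type]
    simp only [Fintype.sum_bool, if_true, Bool.false_eq_true, if_false, ← add_div,
      posPart_add_negPart]
    rw [← Finset.sum_div, l1Norm]; ring
  · rw [Fintype.sum_option, Fintype.sum_prod_type]
    simp only [Fintype.sum_bool, if_true, Bool.false_eq_true, if_false, crossVertex, smul_zero,
      zero_add, smul_smul]
    have : ∀ j, ((u j)⁺ / r * r) • EuclideanSpace.single j (1 : ℝ)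
        + ((u j)⁻ / r * -r) • EuclideanSpace.single j (1 : ℝ) = EuclideanSpace.single j (u j) := by
      intro j
      rw [← add_smul, div_mul_cancel₀ _ hr.ne', mul_neg, div_mul_cancel₀ _ hr.ne',
        ← sub_eq_add_neg, posPart_sub_negPart]
      ext i; simp
    simp only [this]
    ext i
    simp [Finset.sum_apply]

lemma card_sym_cross_le {n k : ℕ} {s : ℝ} (hk : 0 < k) (hs : 0 < s) (hsn : s ≤ n) (hsk : s ≤ k) :
    (Fintype.card (Sym (Option (Fin n × Bool)) k) : ℝ)
      ≤ Real.exp (4 * k * Real.log (2 * n / s)) := by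
  have hk' : (0 : ℝ) < k := by exact_mod_cast hk
  have hcard : Fintype.card (Sym (Option (Fin n × Bool)) k) = (2 * n + k).choose k := by
    rw [Sym.card_sym_eq_choose]
    simp only [Fintype.card_option, Fintype.card_prod, Fintype.card_fin, Fintype.card_bool]
    congr 1; omega
  have hy : 2 ≤ 2 * n / s := by rw [le_div_iff₀ hs]; linarith
  set y := 2 * n / s with hydef
  have hlog : 1 / 2 ≤ Real.log y :=
    (by linarith [Real.log_two_gt_d9] : (1 : ℝ) / 2 ≤ Real.log 2).trans
      (Real.log_le_log (by norm_num) hy)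
  -- The ratio is at most `y + 1`, as `s ≤ k`, and `y + 1 ≤ y ^ 2` for `y ≥ 2`.
  have hratio : ((2 * n + k : ℕ) : ℝ) / k ≤ y ^ 2 := by
    have : (2 * n : ℝ) / k ≤ y := by rw [hydef]; gcongr
    push_cast
    rw [add_div, div_self hk'.ne']
    nlinarith
  rw [hcard]
  calc ((2 * n + k).choose k : ℝ) ≤ ((2 * n + k : ℕ) : ℝ) ^ k / k.factorial :=
        Nat.choose_le_pow_div _ _
    _ = (((2 * n + k : ℕ) : ℝ) / k) ^ k * ((k : ℝ) ^ k / k.factorial) := by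
        rw [div_pow]; field_simp
    _ ≤ (y ^ 2) ^ k * Real.exp k := by
        gcongr; exact Real.pow_div_factorial_le_exp _ hk'.le k
    _ = Real.exp (2 * k * Real.log y + k) := by
        have hy0 : 0 < y := by linarith
        rw [Real.exp_add, ← pow_mul, ← Real.rpow_natCast, Real.rpow_def_of_pos hy0]
        push_cast; ring_nf
    _ ≤ _ := by
        apply Real.exp_le_exp.2; nlinarith

/-! ### Independence of the pairs (measurement vector, measurement). -/

section Model

variable {Ω : Type*} [mΩ : MeasurableSpace Ω] {μ : Measure Ω}
  {m n : ℕ} {S : Matrix (Fin n) (Fin n) ℝ} {x : EuclideanSpace ℝ (Fin n)} {θ : ℝ → ℝ}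
  {a : Fin m → Ω → EuclideanSpace ℝ (Fin n)} {y : Fin m → Ω → ℝ}

lemma IsModel.abs_y (h : IsModel μ S x θ a y) (i : Fin m) (ω : Ω) : |y i ω| = 1 := by
  rcases h.y_mem i ω with h | h <;> simp [h]

lemma IsModel.integrable_y [IsProbabilityMeasure μ]
    (h : IsModel μ S x θ a y) (i : Fin m) : Integrable (y i) μ :=
  Integrable.of_bound (h.measurable_y i).aestronglyMeasurable 1
    (ae_of_all _ fun ω => (h.abs_y i ω).le)

lemma IsModel.comap_le (h : IsModel μ S x θ a y) :
    MeasurableSpace.comap (fun ω i => a i ω) inferInstance ≤ mΩ :=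
  (measurable_pi_lambda _ h.measurable_a).comap_le

/-- The conditional probability of `y i ∈ B` as a function of the measurement vector. -/
noncomputable def condProb (x : EuclideanSpace ℝ (Fin n)) (θ : ℝ → ℝ) (B : Set ℝ)
    (v : EuclideanSpace ℝ (Fin n)) : ℝ :=
  (B.indicator 1 1 + B.indicator 1 (-1)) / 2
    + (B.indicator 1 1 - B.indicator 1 (-1)) / 2 * θ (inner ℝ v x)

lemma IsModel.measurable_condProb (h : IsModel μ S x θ a y) (B : Set ℝ) :
    Measurable (condProb x θ B) := by
  have := h.measurable_theta
  unfold condProb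
  fun_prop

/-- On `{-1, 1}` every function is affine, so the conditional mean determines the conditional law.
-/
lemma IsModel.condExp_indicator_y [IsProbabilityMeasure μ]
    (h : IsModel μ S x θ a y) (i : Fin m) (B : Set ℝ) :
    μ⟦y i ⁻¹' B | MeasurableSpace.comap (fun ω i => a i ω) inferInstance⟧
      =ᵐ[μ] fun ω => condProb x θ B (a i ω) := by
  set α : ℝ := (B.indicator 1 1 + B.indicator 1 (-1)) / 2 with hα
  set β : ℝ := (B.indicator 1 1 - B.indicator 1 (-1)) / 2 with hβ
  have e : (y i ⁻¹' B).indicator (fun _ => (1 : ℝ)) = (fun _ => α) + β • y i := by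
    ext ω
    have : (y i ⁻¹' B).indicator (fun _ => (1 : ℝ)) ω = B.indicator 1 (y i ω) := rfl
    rw [this]
    rcases h.y_mem i ω with h | h <;>
      simp only [Pi.add_apply, Pi.smul_apply, h, smul_eq_mul, hα, hβ] <;> ring
  rw [e]
  filter_upwards [condExp_add (integrable_const α) ((h.integrable_y i).smul β)
    (MeasurableSpace.comap (fun ω i => a i ω) inferInstance),
    condExp_smul β (y i) (MeasurableSpace.comap (fun ω i => a i ω) inferInstance) (μ := μ),
    h.condMean_y i] with ω h1 h2 h3
  rw [h1, Pi.add_apply, h2, condExp_const h.comap_le, Pi.smul_apply, h3]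
  rfl

/-- Conditioning on all the `a i` turns the event for the `y i` into a product of functions of the
single `a i`; independence of the `a i` then factors the integral. -/
lemma IsModel.measureReal_iInter [IsProbabilityMeasure μ]
    (h : IsModel μ S x θ a y) (T : Finset (Fin m))
    {A : Fin m → Set (EuclideanSpace ℝ (Fin n))} {B : Fin m → Set ℝ}
    (hA : ∀ i, MeasurableSet (A i)) (hB : ∀ i, MeasurableSet (B i)) :
    μ.real (⋂ i ∈ T, (a i ⁻¹' A i ∩ y i ⁻¹' B i))
      = ∏ i ∈ T, ∫ ω, (A i).indicator (condProb x θ (B i)) (a i ω) ∂μ := by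
  classical
  have hsplit : (⋂ i ∈ T, (a i ⁻¹' A i ∩ y i ⁻¹' B i))
      = (⋂ i ∈ T, y i ⁻¹' B i) ∩ (⋂ i ∈ T, a i ⁻¹' A i) := by
    ext ω; simp only [Set.mem_iInter, Set.mem_inter_iff]; grind
  have hmY : MeasurableSet (⋂ i ∈ T, y i ⁻¹' B i) :=
    Finset.measurableSet_biInter _ fun i _ => h.measurable_y i (hB i)
  have hmA : MeasurableSet[MeasurableSpace.comap (fun ω i => a i ω) inferInstance]
      (⋂ i ∈ T, a i ⁻¹' A i) := by
    refine Finset.measurableSet_biInter _ fun i _ => ?_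
    exact ⟨(fun f => f i) ⁻¹' A i, measurable_pi_apply i (hA i), rfl⟩
  have h1 : μ.real (⋂ i ∈ T, (a i ⁻¹' A i ∩ y i ⁻¹' B i))
      = ∫ ω in ⋂ i ∈ T, a i ⁻¹' A i, (μ⟦⋂ i ∈ T, y i ⁻¹' B i |
        MeasurableSpace.comap (fun ω i => a i ω) inferInstance⟧) ω ∂μ := by
    rw [setIntegral_condExp h.comap_le ((integrable_const (1 : ℝ)).indicator hmY) hmA,
      hsplit, setIntegral_indicator hmY, setIntegral_const, smul_eq_mul, mul_one, Set.inter_comm]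
  have h2 : ∀ᵐ ω ∂μ, (μ⟦⋂ i ∈ T, y i ⁻¹' B i |
        MeasurableSpace.comap (fun ω i => a i ω) inferInstance⟧) ω
        = ∏ i ∈ T, condProb x θ (B i) (a i ω) := by
    have hall := ae_all_iff.2 fun i => h.condExp_indicator_y i (B i)
    filter_upwards [h.condIndep_y T B hB, hall] with ω h3 h4
    rw [h3, Finset.prod_apply]
    exact Finset.prod_congr rfl fun i _ => h4 i
  have h3 : ∀ ω, (⋂ i ∈ T, a i ⁻¹' A i).indicator
      (fun ω => ∏ i ∈ T, condProb x θ (B i) (a i ω)) ω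
      = ∏ i, (if i ∈ T then (A i).indicator (condProb x θ (B i)) else fun _ => 1) (a i ω) := by
    intro ω
    have : ∀ i, (if i ∈ T then (A i).indicator (condProb x θ (B i)) else fun _ => 1) (a i ω)
        = if i ∈ T then (A i).indicator (condProb x θ (B i)) (a i ω) else 1 := fun i => by
      split_ifs <;> rfl
    simp only [this, Fintype.prod_ite_mem]
    by_cases hω : ∀ i ∈ T, a i ω ∈ A i
    · rw [Set.indicator_of_mem (by simpa using hω)]
      exact Finset.prod_congr rfl fun i hi => (Set.indicator_of_mem (hω i hi) _).symm
    · rw [Set.indicator_of_notMem (by simpa using hω)]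
      push Not at hω
      obtain ⟨i, hi, hi'⟩ := hω
      exact (Finset.prod_eq_zero hi (Set.indicator_of_notMem hi' _)).symm
  rw [h1, setIntegral_congr_ae (h.comap_le _ hmA) (h2.mono fun ω hω _ => hω),
    ← integral_indicator (h.comap_le _ hmA)]
  simp only [h3]
  rw [h.indep_a.integral_fun_prod_comp
    (f := fun i => if i ∈ T then (A i).indicator (condProb x θ (B i)) else fun _ => (1 : ℝ))
    (fun i => (h.measurable_a i).aemeasurable) (fun i => ?_)]
  · rw [← Fintype.prod_ite_mem T]
    refine Finset.prod_congr rfl fun i _ => ?_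
    split_ifs <;> simp
  · split_ifs
    · exact ((h.measurable_condProb (B i)).indicator (hA i)).aestronglyMeasurable
    · exact aestronglyMeasurable_const

lemma IsModel.iIndepFun_pair [IsProbabilityMeasure μ]
    (h : IsModel μ S x θ a y) :
    iIndepFun (fun i ω => (a i ω, y i ω)) μ := by
  have hmeas : ∀ i, Measurable (fun ω => (a i ω, y i ω)) := fun i =>
    (h.measurable_a i).prodMk (h.measurable_y i)
  rw [iIndepFun_iff_iIndep]
  refine iIndepSets.iIndep (fun i => (hmeas i).comap_le)
    (fun i => (fun s => (fun ω => (a i ω, y i ω)) ⁻¹' s) '' (Set.image2 (· ×ˢ ·)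
      { s : Set (EuclideanSpace ℝ (Fin n)) | MeasurableSet s } { t : Set ℝ | MeasurableSet t }))
    (fun i => ?_) (fun i => ?_) ?_
  · exact isPiSystem_prod.comap (fun ω => (a i ω, y i ω))
  · rw [← generateFrom_prod, MeasurableSpace.comap_generateFrom]
  · rw [iIndepSets_iff]
    intro T f hf
    have hf' : ∀ i, ∃ A : Set (EuclideanSpace ℝ (Fin n)), ∃ B : Set ℝ, MeasurableSet A ∧
        MeasurableSet B ∧ (i ∈ T → f i = a i ⁻¹' A ∩ y i ⁻¹' B) := by
      intro i
      by_cases hi : i ∈ T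
      · obtain ⟨_, ⟨A, hA, B, hB, rfl⟩, hfi⟩ := hf i hi
        exact ⟨A, B, hA, hB, fun _ => hfi.symm⟩
      · exact ⟨∅, ∅, .empty, .empty, fun h => absurd h hi⟩
    choose A B hA hB hAB using hf'
    rw [Set.iInter₂_congr hAB, Finset.prod_congr rfl fun i hi => congrArg μ (hAB i hi)]
    have h1 := h.measureReal_iInter T hA hB
    have h2 : ∀ i, μ.real (a i ⁻¹' A i ∩ y i ⁻¹' B i)
        = ∫ ω, (A i).indicator (condProb x θ (B i)) (a i ω) ∂μ := fun i => by
      simpa using h.measureReal_iInter {i} hA hB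
    simp only [← h2] at h1
    simp only [measureReal_def, ← ENNReal.toReal_prod] at h1
    exact (ENNReal.toReal_eq_toReal_iff' (measure_ne_top _ _)
      (ENNReal.prod_ne_top fun i _ => measure_ne_top _ _)).1 h1

/-! ### Gaussian moments and the mean of the objective. -/

lemma IsModel.hasGaussianLaw_a (h : IsModel μ S x θ a y) (i : Fin m) :
    HasGaussianLaw (a i) μ := (h.law_a i).hasGaussianLaw

lemma IsModel.integral_inner [IsProbabilityMeasure μ]
    (h : IsModel μ S x θ a y) (i : Fin m)
    (w : EuclideanSpace ℝ (Fin n)) : ∫ ω, inner ℝ (a i ω) w ∂μ = 0 := by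
  have h1 : ∫ ω, a i ω ∂μ = 0 := by
    rw [(h.law_a i).integral_eq, integral_id_multivariateGaussian]
  simp_rw [real_inner_comm w]
  rw [_root_.integral_inner (h.hasGaussianLaw_a i).integrable, h1, inner_zero_right]

lemma IsModel.covariance_inner (h : IsModel μ S x θ a y) (hS : S.PosSemidef) (i : Fin m)
    (v w : EuclideanSpace ℝ (Fin n)) :
    cov[fun ω => inner ℝ (a i ω) v, fun ω => inner ℝ (a i ω) w; μ]
      = inner ℝ (sqrtMap S v) (sqrtMap S w) := by
  rw [inner_sqrtMap_eq_dotProduct hS, ← covarianceBilin_multivariateGaussian (μ := 0) hS,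
    covarianceBilin_apply_eq_cov IsGaussian.memLp_two_id,
    ← (h.law_a i).covariance_fun_comp (by fun_prop) (by fun_prop)]
  simp_rw [real_inner_comm v, real_inner_comm w]

lemma IsModel.hasGaussianLaw_inner [IsProbabilityMeasure μ]
    (h : IsModel μ S x θ a y) (i : Fin m)
    (w : EuclideanSpace ℝ (Fin n)) : HasGaussianLaw (fun ω => inner ℝ (a i ω) w) μ := by
  simp_rw [real_inner_comm w]
  exact (h.hasGaussianLaw_a i).map_fun (innerSL ℝ w)

lemma IsModel.map_inner [IsProbabilityMeasure μ]
    (h : IsModel μ S x θ a y) (hS : S.PosSemidef) (i : Fin m)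
    (w : EuclideanSpace ℝ (Fin n)) :
    μ.map (fun ω => inner ℝ (a i ω) w) = gaussianReal 0 (‖sqrtMap S w‖ ^ 2).toNNReal := by
  rw [(h.hasGaussianLaw_inner i w).map_eq_gaussianReal, h.integral_inner,
    ← covariance_self (h.hasGaussianLaw_inner i w).aemeasurable, h.covariance_inner hS,
    real_inner_self_eq_norm_sq]

lemma IsModel.abs_theta_le [IsProbabilityMeasure μ]
    (h : IsModel μ S x θ a y) (i : Fin m) :
    ∀ᵐ ω ∂μ, |θ (inner ℝ (a i ω) x)| ≤ 1 := by
  filter_upwards [h.condMean_y i, ae_bdd_abs_condExp_of_ae_bdd_abs (R := 1)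
    (m := MeasurableSpace.comap (fun ω i => a i ω) inferInstance)
    (ae_of_all μ fun ω => (h.abs_y i ω).le)] with ω h1 h2
  rwa [← h1]

/-- Split `w = ρ x + (w - ρ x)`: the projection of `a i` on the second part is uncorrelated with `⟨a
i, x⟩`, hence independent of it by joint Gaussianity, and contributes zero. -/
lemma IsModel.integral_theta_mul_inner [IsProbabilityMeasure μ]
    (h : IsModel μ S x θ a y) (hS : S.PosSemidef)
    (hx : ‖sqrtMap S x‖ = 1) (i : Fin m) (w : EuclideanSpace ℝ (Fin n)) :
    ∫ ω, θ (inner ℝ (a i ω) x) * inner ℝ (a i ω) w ∂μ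
      = correlation θ * inner ℝ (sqrtMap S x) (sqrtMap S w) := by
  have hθ := h.measurable_theta
  have ha := h.measurable_a i
  have hint : ∀ v, Integrable (fun ω => θ (inner ℝ (a i ω) x) * inner ℝ (a i ω) v) μ := fun v =>
    (h.hasGaussianLaw_inner i v).integrable.bdd_mul (c := 1)
      (Measurable.aestronglyMeasurable (by fun_prop)) (h.abs_theta_le i)
  set ρ := inner ℝ (sqrtMap S x) (sqrtMap S w) with hρ
  have hdec : ∀ ω, θ (inner ℝ (a i ω) x) * inner ℝ (a i ω) w
      = ρ * (θ (inner ℝ (a i ω) x) * inner ℝ (a i ω) x)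
        + θ (inner ℝ (a i ω) x) * inner ℝ (a i ω) (w - ρ • x) := fun ω => by
    rw [inner_sub_right, inner_smul_right]; ring
  have hpair : HasGaussianLaw
      (fun ω => (inner ℝ (a i ω) x, inner ℝ (a i ω) (w - ρ • x))) μ := by
    have e : (fun ω => (inner ℝ (a i ω) x, inner ℝ (a i ω) (w - ρ • x)))
        = fun ω => ((innerSL ℝ x).prod (innerSL ℝ (w - ρ • x))) (a i ω) :=
      funext fun ω => Prod.ext (real_inner_comm _ _) (real_inner_comm _ _)
    rw [e]
    exact (h.hasGaussianLaw_a i).map_fun _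
  have hind : (fun ω => inner ℝ (a i ω) x) ⟂ᵢ[μ] (fun ω => inner ℝ (a i ω) (w - ρ • x)) := by
    refine hpair.indepFun_of_covariance_eq_zero ?_
    rw [h.covariance_inner hS, map_sub, map_smul, inner_sub_right, inner_smul_right,
      real_inner_self_eq_norm_sq, hx, hρ]
    ring
  have h0 : ∫ ω, θ (inner ℝ (a i ω) x) * inner ℝ (a i ω) (w - ρ • x) ∂μ = 0 := by
    have := (hind.comp hθ measurable_id).integral_fun_mul_eq_mul_integral
      (Measurable.aestronglyMeasurable (by fun_prop))
      (Measurable.aestronglyMeasurable (by fun_prop))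
    simp only [Function.comp_apply, id_eq] at this
    rw [this]
    simp [h.integral_inner]
  have h1 : ∫ ω, θ (inner ℝ (a i ω) x) * inner ℝ (a i ω) x ∂μ = correlation θ := by
    have := integral_map (μ := μ) (φ := fun ω => inner ℝ (a i ω) x) (f := fun z => θ z * z)
      (by fun_prop) (Measurable.aestronglyMeasurable (by fun_prop))
    rw [← this, h.map_inner hS, hx, correlation]
    simp
  simp_rw [hdec]
  rw [integral_add ((hint x).const_mul ρ) (hint _), integral_const_mul, h0, h1]
  ring

lemma IsModel.integrable_y_mul_inner [IsProbabilityMeasure μ]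
    (h : IsModel μ S x θ a y) (i : Fin m)
    (w : EuclideanSpace ℝ (Fin n)) : Integrable (fun ω => y i ω * inner ℝ (a i ω) w) μ :=
  (h.hasGaussianLaw_inner i w).integrable.bdd_mul (c := 1)
    (h.measurable_y i).aestronglyMeasurable (ae_of_all _ fun ω => (h.abs_y i ω).le)

lemma IsModel.integral_y_mul_inner [IsProbabilityMeasure μ]
    (h : IsModel μ S x θ a y) (hS : S.PosSemidef)
    (hx : ‖sqrtMap S x‖ = 1) (i : Fin m) (w : EuclideanSpace ℝ (Fin n)) :
    ∫ ω, y i ω * inner ℝ (a i ω) w ∂μ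
      = correlation θ * inner ℝ (sqrtMap S x) (sqrtMap S w) := by
  rw [← h.integral_theta_mul_inner hS hx i w, ← integral_condExp h.comap_le]
  have hm : StronglyMeasurable[MeasurableSpace.comap (fun ω i => a i ω) inferInstance]
      (fun ω => inner ℝ (a i ω) w) := by
    have : Measurable (fun f : Fin m → EuclideanSpace ℝ (Fin n) => inner ℝ (f i) w) := by fun_prop
    exact (this.comp (comap_measurable (fun ω i => a i ω))).stronglyMeasurable
  have e : (fun ω => y i ω * inner ℝ (a i ω) w) = (fun ω => inner ℝ (a i ω) w) * y i := by
    ext ω; simp [mul_comm]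
  refine integral_congr_ae ?_
  have hi := h.integrable_y_mul_inner i w
  rw [e] at hi ⊢
  filter_upwards [condExp_mul_of_stronglyMeasurable_left hm hi (h.integrable_y i),
    h.condMean_y i] with ω h1 h2
  rw [h1, Pi.mul_apply, h2, mul_comm]

/-! ### Sub-Gaussian tails of the deviation. -/

lemma IsModel.integrable_exp_inner [IsProbabilityMeasure μ]
    (h : IsModel μ S x θ a y) (hS : S.PosSemidef) (i : Fin m)
    (w : EuclideanSpace ℝ (Fin n)) (t : ℝ) :
    Integrable (fun ω => Real.exp (t * inner ℝ (a i ω) w)) μ := by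
  have h1 := integrable_exp_mul_gaussianReal (μ := 0) (v := (‖sqrtMap S w‖ ^ 2).toNNReal) t
  rw [← h.map_inner hS i w] at h1
  exact h1.comp_aemeasurable (h.hasGaussianLaw_inner i w).aemeasurable

lemma IsModel.integral_exp_inner [IsProbabilityMeasure μ]
    (h : IsModel μ S x θ a y) (hS : S.PosSemidef) (i : Fin m)
    (w : EuclideanSpace ℝ (Fin n)) (t : ℝ) :
    ∫ ω, Real.exp (t * inner ℝ (a i ω) w) ∂μ = Real.exp (‖sqrtMap S w‖ ^ 2 * t ^ 2 / 2) := by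
  have := mgf_gaussianReal (h.map_inner hS i w) t
  simpa [mgf] using this

/-- The symmetrized exponential does not see the sign `y i`, so it reduces to a Gaussian one
whatever the dependence of `y i` on `a i`. -/
lemma IsModel.exp_y_mul_inner (h : IsModel μ S x θ a y) (i : Fin m)
    (w : EuclideanSpace ℝ (Fin n)) (t : ℝ) (ω : Ω) :
    Real.exp (t * (y i ω * inner ℝ (a i ω) w)) + Real.exp (-t * (y i ω * inner ℝ (a i ω) w))
      = Real.exp (t * inner ℝ (a i ω) w) + Real.exp (-t * inner ℝ (a i ω) w) := by
  rcases h.y_mem i ω with hy | hy <;> rw [hy]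
  · simp
  · rw [add_comm]; congr 2 <;> ring

lemma IsModel.integrable_exp_y_mul_inner [IsProbabilityMeasure μ]
    (h : IsModel μ S x θ a y) (hS : S.PosSemidef)
    (i : Fin m) (w : EuclideanSpace ℝ (Fin n)) (t : ℝ) :
    Integrable (fun ω => Real.exp (t * (y i ω * inner ℝ (a i ω) w))) μ := by
  have hy := h.measurable_y i
  have ha := h.measurable_a i
  refine ((h.integrable_exp_inner hS i w t).add (h.integrable_exp_inner hS i w (-t))).mono'
    (Measurable.aestronglyMeasurable (by fun_prop)) (ae_of_all _ fun ω => ?_)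
  rw [Real.norm_of_nonneg (Real.exp_pos _).le, Pi.add_apply, ← h.exp_y_mul_inner i w t ω]
  linarith [Real.exp_pos (-t * (y i ω * inner ℝ (a i ω) w))]

/-- If `Y` is a random variable with `𝔼 e^{tY} + 𝔼 e^{-tY} ≤ 2 e^{v t² / 2}` for all `t`, then
`Y` minus its mean is sub-Gaussian with variance proxy `2 v`. -/
lemma hasSubgaussianMGF_sub_integral [IsProbabilityMeasure μ]
    {Y : Ω → ℝ} {v : NNReal} (hY : Integrable Y μ)
    (hexp : ∀ t : ℝ, Integrable (fun ω => Real.exp (t * Y ω)) μ)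
    (hbound : ∀ t : ℝ, ∫ ω, Real.exp (t * Y ω) ∂μ + ∫ ω, Real.exp (-t * Y ω) ∂μ
      ≤ 2 * Real.exp (v * t ^ 2 / 2)) :
    HasSubgaussianMGF (fun ω => Y ω - ∫ ω', Y ω' ∂μ) (2 * v) μ := by
  set M := ∫ ω', Y ω' ∂μ with hM
  have hs : ∀ t ω, Real.exp (t * (Y ω - M)) = Real.exp (-t * M) * Real.exp (t * Y ω) := by
    intro t ω
    rw [← Real.exp_add]; ring_nf
  have hint : ∀ t : ℝ, Integrable (fun ω => Real.exp (t * (Y ω - M))) μ := fun t => by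
    simp_rw [hs]
    exact (hexp t).const_mul _
  refine ⟨hint, fun t => ?_⟩
  have hmgf : ∀ t, mgf (fun ω => Y ω - M) μ t = Real.exp (-t * M) * ∫ ω, Real.exp (t * Y ω) ∂μ := by
    intro t
    simp_rw [mgf, hs]
    rw [integral_const_mul]
  have hlin : Integrable (fun ω => -t * (Y ω - M)) μ := (hY.sub (integrable_const _)).const_mul _
  -- Jensen's inequality for the centred variable, via `1 + z ≤ e^z`.
  have hone : 1 ≤ mgf (fun ω => Y ω - M) μ (-t) := by
    have h1 : ∫ ω, (1 + -t * (Y ω - M)) ∂μ = 1 := by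
      rw [integral_add (integrable_const _) hlin,
        integral_const_mul, integral_sub hY (integrable_const _)]
      simp [hM]
    rw [← h1]
    refine integral_mono ((integrable_const _).add hlin)
      (hint (-t)) fun ω => ?_
    dsimp only
    rw [add_comm]
    exact Real.add_one_le_exp _
  set p := ∫ ω, Real.exp (t * Y ω) ∂μ
  set q := ∫ ω, Real.exp (-t * Y ω) ∂μ
  have hp : 0 ≤ p := integral_nonneg fun _ => (Real.exp_pos _).le
  have hq : 0 ≤ q := integral_nonneg fun _ => (Real.exp_pos _).le
  have hb : p + q ≤ 2 * Real.exp (v * t ^ 2 / 2) := hbound t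
  -- Multiplying by the factor at `-t` cancels the mean; AM-GM on `p * q` then squares the bound,
  -- which doubles the variance proxy.
  calc mgf (fun ω => Y ω - M) μ t
      ≤ mgf (fun ω => Y ω - M) μ t * mgf (fun ω => Y ω - M) μ (-t) :=
        le_mul_of_one_le_right mgf_nonneg hone
    _ = p * q := by
        rw [hmgf, hmgf]
        have : Real.exp (-t * M) * Real.exp (- -t * M) = 1 := by
          rw [← Real.exp_add]; simp
        linear_combination (p * q) * this
    _ ≤ Real.exp (v * t ^ 2 / 2) ^ 2 := by
        nlinarith [sq_nonneg (p - q), Real.exp_pos (v * t ^ 2 / 2)]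
    _ = Real.exp ((2 * v : NNReal) * t ^ 2 / 2) := by
        rw [← Real.exp_nat_mul]; push_cast; ring_nf

lemma IsModel.hasSubgaussianMGF_y_mul_inner [IsProbabilityMeasure μ]
    (h : IsModel μ S x θ a y) (hS : S.PosSemidef)
    (hx : ‖sqrtMap S x‖ = 1) (i : Fin m) (w : EuclideanSpace ℝ (Fin n)) :
    HasSubgaussianMGF (fun ω => y i ω * inner ℝ (a i ω) w
      - correlation θ * inner ℝ (sqrtMap S x) (sqrtMap S w)) (2 * ‖sqrtMap S w‖₊ ^ 2) μ := by
  rw [← h.integral_y_mul_inner hS hx i w]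
  refine hasSubgaussianMGF_sub_integral (h.integrable_y_mul_inner i w)
    (h.integrable_exp_y_mul_inner hS i w) fun t => ?_
  rw [← integral_add (h.integrable_exp_y_mul_inner hS i w t)
    (h.integrable_exp_y_mul_inner hS i w (-t))]
  simp_rw [h.exp_y_mul_inner]
  rw [integral_add (h.integrable_exp_inner hS i w t) (h.integrable_exp_inner hS i w (-t)),
    h.integral_exp_inner hS, h.integral_exp_inner hS, neg_sq]
  push_cast
  rw [two_mul]

/-- The deviation of the objective from its mean, as a linear functional. -/
noncomputable def deviation (S : Matrix (Fin n) (Fin n) ℝ) (x : EuclideanSpace ℝ (Fin n))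
    (θ : ℝ → ℝ) (a : Fin m → EuclideanSpace ℝ (Fin n)) (y : Fin m → ℝ) :
    EuclideanSpace ℝ (Fin n) →ₗ[ℝ] ℝ :=
  ∑ i, (y i • innerₛₗ ℝ (a i) - correlation θ •
    (innerₛₗ ℝ (sqrtMap S x)).comp (sqrtMap S).toLinearMap)

lemma deviation_apply (S : Matrix (Fin n) (Fin n) ℝ) (x : EuclideanSpace ℝ (Fin n))
    (θ : ℝ → ℝ) (a : Fin m → EuclideanSpace ℝ (Fin n)) (y : Fin m → ℝ)
    (w : EuclideanSpace ℝ (Fin n)) :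
    deviation S x θ a y w = ∑ i, (y i * inner ℝ (a i) w
      - correlation θ * inner ℝ (sqrtMap S x) (sqrtMap S w)) := by
  simp [deviation]

lemma IsModel.measurable_deviation (h : IsModel μ S x θ a y) (w : EuclideanSpace ℝ (Fin n)) :
    Measurable fun ω => deviation S x θ (fun i => a i ω) (fun i => y i ω) w := by
  simp_rw [deviation_apply]
  have hy := h.measurable_y
  have ha := h.measurable_a
  fun_prop

/-- Chernoff's bound at a fixed `t`: the variance proxy `2 m ‖A w‖²` stays in the threshold, in the
form of the penalty. -/
lemma IsModel.measureReal_deviation_ge_le [IsProbabilityMeasure μ]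
    (h : IsModel μ S x θ a y) (hS : S.PosSemidef)
    (hx : ‖sqrtMap S x‖ = 1) (w : EuclideanSpace ℝ (Fin n)) {t : ℝ} (ht : 0 < t) (r : ℝ) :
    μ.real {ω | t * m * ‖sqrtMap S w‖ ^ 2 + r / t
      ≤ deviation S x θ (fun i => a i ω) (fun i => y i ω) w} ≤ Real.exp (-r) := by
  have hind : iIndepFun (fun i ω => y i ω * inner ℝ (a i ω) w
      - correlation θ * inner ℝ (sqrtMap S x) (sqrtMap S w)) μ :=
    h.iIndepFun_pair.comp (fun _ p => p.2 * inner ℝ p.1 w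
      - correlation θ * inner ℝ (sqrtMap S x) (sqrtMap S w)) (fun _ => by fun_prop)
  have hsub := HasSubgaussianMGF.sum_of_iIndepFun hind (s := Finset.univ)
    (fun i _ => h.hasSubgaussianMGF_y_mul_inner hS hx i w)
  simp_rw [deviation_apply]
  refine (measure_ge_le_exp_mul_mgf _ ht.le (hsub.integrable_exp_mul t)).trans ?_
  refine (mul_le_mul_of_nonneg_left (hsub.mgf_le t) (Real.exp_pos _).le).trans ?_
  rw [← Real.exp_add]
  refine Real.exp_le_exp.2 (le_of_eq ?_)
  simp only [Finset.sum_const, Finset.card_univ, Fintype.card_fin, nsmul_eq_mul]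
  push_cast
  field_simp
  ring

end Model

/-! ### The uniform bound and the error estimate. -/

/-- With high probability the deviation is uniformly small on the feasible set. -/
lemma IsModel.exists_event_deviation_le {Ω : Type*} [MeasurableSpace Ω] {μ : Measure Ω}
    [IsProbabilityMeasure μ] {m n : ℕ} {S : Matrix (Fin n) (Fin n) ℝ}
    {x : EuclideanSpace ℝ (Fin n)} {θ : ℝ → ℝ} {a : Fin m → Ω → EuclideanSpace ℝ (Fin n)}
    {y : Fin m → Ω → ℝ} (h : IsModel μ S x θ a y) (hn : 0 < n) (hS : S.PosDef)
    (hx : ‖sqrtMap S x‖ = 1) {s : ℝ} (hs : 1 ≤ s) (hsn : s ≤ n) {δ : ℝ} (hδ : 0 < δ)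
    (hm : 2048 * condNumber S * (δ ^ 2)⁻¹ * s * Real.log (2 * n / s) ≤ m) :
    ∃ E : Set Ω, MeasurableSet E ∧ 1 - Real.exp (-(1 / 256) * δ ^ 2 * m) ≤ μ.real E ∧
      ∀ ω ∈ E, ∀ u ∈ feasibleSet S s,
        deviation S x θ (fun i => a i ω) (fun i => y i ω) u ≤ δ * m / 4 := by
  have hs0 : 0 < s := by linarith
  have hl := lambdaMin_pos hn hS
  have hκ := one_le_condNumber hn hS
  set κ := condNumber S with hκdef
  have hκs : s ≤ κ * s := le_mul_of_one_le_left hs0.le hκ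
  set k := ⌈κ * s⌉₊ with hkdef
  have hkge : κ * s ≤ k := Nat.le_ceil _
  have hkle : (k : ℝ) ≤ 2 * (κ * s) := by
    linarith [Nat.ceil_lt_add_one (by linarith : 0 ≤ κ * s)]
  have hk0 : (0 : ℝ) < k := by linarith
  have hk : 0 < k := by exact_mod_cast hk0
  have hlog : 0 ≤ Real.log (2 * n / s) :=
    Real.log_nonneg (by rw [le_div_iff₀ hs0]; linarith)
  set r := √(s / lambdaMin S) with hr
  have hr0 : 0 < r := Real.sqrt_pos.2 (by positivity)
  -- With `c = t m`, the penalty at `u` is at most `2 t m = δ m / 8`, and `ρ / t = δ m / 8` as well.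
  set t := δ / 16 with ht
  have ht0 : 0 < t := by positivity
  set ρ := δ ^ 2 * m / 128 with hρ
  let w : Sym (Option (Fin n × Bool)) k → EuclideanSpace ℝ (Fin n) := fun σ =>
    (k : ℝ)⁻¹ • (σ.1.map (crossVertex r)).sum
  let bad : Sym (Option (Fin n × Bool)) k → Set Ω := fun σ =>
    {ω | t * m * ‖sqrtMap S (w σ)‖ ^ 2 + ρ / t
      ≤ deviation S x θ (fun i => a i ω) (fun i => y i ω) (w σ)}
  have hbadm : ∀ σ, MeasurableSet (bad σ) := fun σ =>
    measurableSet_le measurable_const (h.measurable_deviation _)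
  have hbadU : MeasurableSet (⋃ σ, bad σ) := MeasurableSet.iUnion hbadm
  refine ⟨(⋃ σ, bad σ)ᶜ, hbadU.compl, ?_, fun ω hω u hu => ?_⟩
  · rw [probReal_compl_eq_one_sub hbadU]
    refine sub_le_sub_left ?_ 1
    -- The logarithm of the number of multisets is at most `ρ / 2`, leaving `exp (-ρ / 2)` for the
    -- failure probability.
    have hcount : 4 * k * Real.log (2 * n / s) ≤ δ ^ 2 * m / 256 := by
      have e : 2048 * κ * (δ ^ 2)⁻¹ * s * Real.log (2 * n / s)
          = 2048 * κ * s * Real.log (2 * n / s) / δ ^ 2 := by ring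
      rw [e, div_le_iff₀ (by positivity)] at hm
      nlinarith [mul_le_mul_of_nonneg_right hkle hlog]
    calc μ.real (⋃ σ, bad σ) ≤ ∑ σ, μ.real (bad σ) := measureReal_iUnion_fintype_le _
      _ ≤ ∑ _σ : Sym (Option (Fin n × Bool)) k, Real.exp (-ρ) := Finset.sum_le_sum fun σ _ =>
          h.measureReal_deviation_ge_le hS.posSemidef hx (w σ) ht0 ρ
      _ = Fintype.card (Sym (Option (Fin n × Bool)) k) * Real.exp (-ρ) := by
          rw [Finset.sum_const, Finset.card_univ, nsmul_eq_mul]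
      _ ≤ Real.exp (4 * k * Real.log (2 * n / s)) * Real.exp (-ρ) := by
          gcongr
          exact card_sym_cross_le hk hs0 hsn (hκs.trans hkge)
      _ ≤ Real.exp (-(1 / 256) * δ ^ 2 * m) := by
          rw [← Real.exp_add]
          refine Real.exp_le_exp.2 ?_
          rw [hρ]; linarith
  · obtain ⟨p, hp, hp1, hpu⟩ := exists_weights_of_l1Norm_le hr0 hu.1
    have hB : ∀ i, ‖(sqrtMap S).toLinearMap (crossVertex r i)‖ ^ 2 ≤ κ * s := fun i => by
      have hlmax : 0 ≤ lambdaMax S := hl.le.trans (lambdaMin_le_lambdaMax hn hS)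
      calc ‖sqrtMap S (crossVertex r i)‖ ^ 2 ≤ lambdaMax S * ‖crossVertex r i‖ ^ 2 :=
            sq_le_lambdaMax_mul hS _
        _ ≤ lambdaMax S * r ^ 2 := by exact mul_le_mul_of_nonneg_left (norm_crossVertex_sq_le r i) hlmax
        _ = κ * s := by
            rw [hr, Real.sq_sqrt (by positivity), hκdef, condNumber]; ring
    obtain ⟨σ, hσ⟩ := exists_sym_average
      (deviation S x θ (fun i => a i ω) (fun i => y i ω)) (sqrtMap S).toLinearMap
      (crossVertex r) p hp hp1 (c := t * m) (by positivity) hB hk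
    rw [hpu] at hσ
    have hgood : deviation S x θ (fun i => a i ω) (fun i => y i ω) (w σ)
        < t * m * ‖sqrtMap S (w σ)‖ ^ 2 + ρ / t := by
      by_contra! hcon
      exact hω (Set.mem_iUnion.2 ⟨σ, hcon⟩)
    have hu1 : ‖sqrtMap S u‖ ^ 2 ≤ 1 := pow_le_one₀ (norm_nonneg _) hu.2
    have hB1 : κ * s / k ≤ 1 := (div_le_one hk0).2 hkge
    have htm : 0 ≤ t * m := by positivity
    have hpen : t * m * (‖sqrtMap S u‖ ^ 2 + κ * s / k) ≤ t * m * 2 := by gcongr; linarith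
    have hval : t * m * 2 + ρ / t = δ * m / 4 := by rw [hρ, ht]; field_simp; ring
    simp only [ContinuousLinearMap.coe_coe] at hσ
    change _ ≤ deviation S x θ (fun i => a i ω) (fun i => y i ω) (w σ)
      - t * m * ‖sqrtMap S (w σ)‖ ^ 2 at hσ
    linarith

/-- A uniform bound on the deviation controls the error of every solution. -/
lemma norm_sqrtMap_sub_sq_le_of_deviation_le {m n : ℕ} (hm : 0 < m)
    {S : Matrix (Fin n) (Fin n) ℝ} {s δ : ℝ} {x xhat : EuclideanSpace ℝ (Fin n)} {θ : ℝ → ℝ}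
    {a : Fin m → EuclideanSpace ℝ (Fin n)} {y : Fin m → ℝ} (hθ : 0 < correlation θ)
    (hx : ‖sqrtMap S x‖ = 1) (hxK : x ∈ feasibleSet S s)
    (hdev : ∀ u ∈ feasibleSet S s, deviation S x θ a y u ≤ δ * m / 4)
    (hsol : IsSolution S s a y xhat) :
    ‖sqrtMap S xhat - sqrtMap S x‖ ^ 2 ≤ δ / correlation θ := by
  have hm' : (0 : ℝ) < m := by exact_mod_cast hm
  have h1 := hdev _ (half_sub_mem_feasibleSet hsol.1 hxK)
  rw [map_smul, map_sub, smul_eq_mul, deviation_apply, deviation_apply,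
    Finset.sum_sub_distrib, Finset.sum_sub_distrib] at h1
  simp only [Finset.sum_const, Finset.card_univ, Fintype.card_fin, nsmul_eq_mul,
    real_inner_self_eq_norm_sq, hx] at h1
  have h2 : ∑ i, y i * inner ℝ (a i) x ≤ ∑ i, y i * inner ℝ (a i) xhat := hsol.2 hxK
  have h3 : correlation θ * (1 - inner ℝ (sqrtMap S x) (sqrtMap S xhat)) ≤ δ / 2 := by
    refine le_of_mul_le_mul_left ?_ hm'
    linarith
  have h4 : ‖sqrtMap S xhat‖ ^ 2 ≤ 1 := pow_le_one₀ (norm_nonneg _) hsol.1.2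
  rw [norm_sub_sq_real, hx, real_inner_comm, le_div_iff₀ hθ]
  -- Since `‖A xhat‖ ≤ 1 = ‖A x‖`, the squared distance is at most `2 (1 - ⟨A x, A xhat⟩)`.
  nlinarith

end OneBit

theorem mainTheorem6 :
    ∃ C c : ℝ, 0 < C ∧ 0 < c ∧
      ∀ {Ω : Type*} [MeasurableSpace Ω] (μ : Measure Ω) [IsProbabilityMeasure μ]
        (m n : ℕ) (S : Matrix (Fin n) (Fin n) ℝ) (_ : S.PosDef)
        (s : ℝ) (_ : 0 < s) (_ : s ≤ n)
        (x : EuclideanSpace ℝ (Fin n)) (_ : (OneBit.l0Norm x : ℝ) ≤ s)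
        (_ : ‖OneBit.sqrtMap S x‖ = 1)
        (θ : ℝ → ℝ) (a : Fin m → Ω → EuclideanSpace ℝ (Fin n)) (y : Fin m → Ω → ℝ)
        (_ : OneBit.IsModel μ S x θ a y)
        (δ : ℝ) (_ : 0 < δ)
        (_ : C * OneBit.condNumber S * (δ ^ 2)⁻¹ * s * Real.log (2 * n / s) ≤ m),
        ∃ E : Set Ω, MeasurableSet E ∧
          1 - 8 * Real.exp (-c * δ ^ 2 * m) ≤ μ.real E ∧
          ∀ ω ∈ E,
            (∃ xhat, OneBit.IsSolution S s (fun i => a i ω) (fun i => y i ω) xhat) ∧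
            ∀ xhat, OneBit.IsSolution S s (fun i => a i ω) (fun i => y i ω) xhat →
              OneBit.lambdaMin S * ‖xhat - x‖ ^ 2
                  ≤ ‖OneBit.sqrtMap S xhat - OneBit.sqrtMap S x‖ ^ 2 ∧
              ‖OneBit.sqrtMap S xhat - OneBit.sqrtMap S x‖ ^ 2
                  ≤ δ / OneBit.correlation θ := by
  refine ⟨2048, 1 / 256, by norm_num, by norm_num, ?_⟩
  intro Ω _ μ _ m n S hS s hs hsn x hxs hx θ a y h δ hδ hm
  have hn : 0 < n := by exact_mod_cast hs.trans_le hsn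
  -- The normalization forces `x ≠ 0`, so `x` has a nonzero entry.
  have hs1 : 1 ≤ s := by
    refine le_trans ?_ hxs
    rw [Nat.one_le_cast, Nat.one_le_iff_ne_zero, OneBit.l0Norm, hammingNorm_ne_zero_iff]
    intro h0
    have : x = 0 := PiLp.ext fun i => congrFun h0 i
    simp [this] at hx
  have hm0 : 0 < m := by
    have hκ := OneBit.one_le_condNumber hn hS
    have hlog : 0 < Real.log (2 * n / s) :=
      Real.log_pos (by rw [lt_div_iff₀ hs]; linarith)
    have : (0 : ℝ) < m := lt_of_lt_of_le (by positivity) hm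
    exact_mod_cast this
  have hxK := OneBit.mem_feasibleSet_of_sparse hn hS hxs hx
  obtain ⟨E, hE, hμE, hdev⟩ := h.exists_event_deviation_le hn hS hx hs1 hsn hδ hm
  refine ⟨E, hE, ?_, fun ω hω => ⟨OneBit.exists_isSolution (OneBit.isCompact_feasibleSet hn hS s)
    ⟨x, hxK⟩ _ _, fun xhat hsol => ⟨?_, ?_⟩⟩⟩
  -- The argument gives the constant `1` in place of `8`.
  · linarith [Real.exp_pos (-(1 / 256) * δ ^ 2 * m)]
  · rw [← map_sub]
    exact OneBit.lambdaMin_mul_sq_le hS _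
  · exact OneBit.norm_sqrtMap_sub_sq_le_of_deviation_le hm0 h.correlation_pos hx hxK
      (hdev ω hω) hsol
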